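/- Throughout, let $G$ be a topological group. A function $x:G\to\mathbb C$ is right uniformly continuous if for every $\varepsilon>0$ there is a neighbourhood $V$ of the identity such that $gh^{-1}\in V$ implies $|x(g)-x(h)|<\varepsilon$. Let $RUCB(G)$ be the unital commutative $C^*$-algebra of bounded right uniformly continuous functions $G\to\mathbb C$ (pointwise operations, supremum norm). The equivariant Samuel compactification $S(G)$ is the space of nonzero continuous characters of $RUCB(G)$ with the weak-$*$ topology, on which $G$ acts by $(g\varphi)(x)=\varphi({}^{g^{-1}}x)$, where ${}^{g}x(h)=x(g^{-1}h)$. The group $G$ is non-archimedean if it is Hausdorff and its open subgroups form a base of neighbourhoods of the identity. A projective system of compact $G$-spaces consists of a nonempty directed ordered set $I$, compact Hausdorff spaces $X_i$ ($i\in I$) with continuous actions of $G$, and continuous equivariant maps $\pi_{ij}:X_j\to X_i$ for $i\preceq j$, with $\pi_{ii}=\mathrm{id}$ and $\pi_{ij}\circ\pi_{jk}=\pi_{ik}$ for $i\preceq j\preceq k$. The maps $\pi_{ij}$ are not required to be surjective. Its projective limit is the $G$-space $\{(x_i)\in\prod_i X_i : x_i=\pi_{ij}(x_j)\text{ for all }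 i\preceq j\}$, with the topology induced by the product and the coordinatewise action. **Theorem.** Let $G$ be a non-archimedean Polish group. 1. $S(G)$ is isomorphic, as a topological $G$-space, to the projective limit of a projective system of compact metrizable $G$-spaces of Lebesgue covering dimension zero; moreover the maps $\pi_{ij}$ can be taken surjective. 2. If $G$ is infinite, then $S(G)$ is isomorphic, as a topological $G$-space, to the projective limit of a projective system of $G$-spaces each homeomorphic to the Cantor space $\{0,1\}^{\mathbb N}$; moreover, if $G$ is not discrete, the maps $\pi_{ij}$ of this system can be taken surjective. -/

import Mathlib

open Topology
open scoped BoundedContinuousFunction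

universe u

/-! ### Bounded right uniformly continuous functions -/

section RUCB

variable (G : Type u) [Group G] [TopologicalSpace G]

/-- `x : G → ℂ` is right uniformly continuous: for every `ε > 0` there is a neighbourhood `V` of
the identity such that `g h⁻¹ ∈ V` implies `|x g - x h| < ε`. -/
def IsRightUniformlyContinuous {G : Type u} [Group G] [TopologicalSpace G] (x : G → ℂ) : Prop :=
  ∀ ε : ℝ, 0 < ε → ∃ V ∈ 𝓝 (1 : G), ∀ g h : G, g * h⁻¹ ∈ V → ‖x g - x h‖ < ε

/-- The unital commutative C⋆-algebra `RUCB(G)` of all bounded right uniformly continuous functions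
`G → ℂ`, with pointwise operations and the supremum norm. (When `G` is a topological group, a right
uniformly continuous function is continuous, so working inside `G →ᵇ ℂ` is no restriction; see
`RUCB.ofBounded` below.) -/
def RUCB : StarSubalgebra ℂ (G →ᵇ ℂ) where
  carrier := {x | IsRightUniformlyContinuous (x : G → ℂ)}
  mul_mem' := by
    intro x y hx hy ε hε
    have hC : 0 < ‖x‖ + ‖y‖ + 1 := by positivity
    obtain ⟨V, hV, hxV⟩ := hx (ε / (2 * (‖x‖ + ‖y‖ + 1))) (by positivity)
    obtain ⟨W, hW, hyW⟩ := hy (ε / (2 * (‖x‖ + ‖y‖ + 1))) (by positivity)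
    refine ⟨V ∩ W, Filter.inter_mem hV hW, fun g h hgh => ?_⟩
    have h1 := hxV g h hgh.1
    have h2 := hyW g h hgh.2
    have e : (x * y) g - (x * y) h = x g * (y g - y h) + (x g - x h) * y h := by
      simp only [BoundedContinuousFunction.mul_apply]; ring
    rw [e]
    set δ := ε / (2 * (‖x‖ + ‖y‖ + 1)) with hδ
    have hδ0 : 0 < δ := by positivity
    have hδe : 2 * δ * (‖x‖ + ‖y‖ + 1) = ε := by rw [hδ]; field_simp
    calc ‖x g * (y g - y h) + (x g - x h) * y h‖
        ≤ ‖x g‖ * ‖y g - y h‖ + ‖x g - x h‖ * ‖y h‖ := by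
          refine (norm_add_le _ _).trans ?_
          rw [norm_mul, norm_mul]
      _ ≤ ‖x‖ * δ + δ * ‖y‖ := by
          gcongr
          · exact x.norm_coe_le_norm g
          · exact y.norm_coe_le_norm h
      _ < ε := by nlinarith [norm_nonneg x, norm_nonneg y]
  add_mem' := by
    intro x y hx hy ε hε
    obtain ⟨V, hV, hxV⟩ := hx (ε / 2) (by positivity)
    obtain ⟨W, hW, hyW⟩ := hy (ε / 2) (by positivity)
    refine ⟨V ∩ W, Filter.inter_mem hV hW, fun g h hgh => ?_⟩
    have h1 := hxV g h hgh.1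
    have h2 := hyW g h hgh.2
    have e : (x + y) g - (x + y) h = (x g - x h) + (y g - y h) := by
      simp only [BoundedContinuousFunction.add_apply]; ring
    rw [e]
    exact (norm_add_le _ _).trans_lt (by linarith)
  algebraMap_mem' := by
    intro c ε hε
    refine ⟨Set.univ, Filter.univ_mem, fun g h _ => ?_⟩
    simpa [BoundedContinuousFunction.algebraMap_apply] using hε
  star_mem' := by
    intro x hx ε hε
    obtain ⟨V, hV, hxV⟩ := hx ε hε
    refine ⟨V, hV, fun g h hgh => ?_⟩
    have e : (star x) g - (star x) h = star (x g - x h) := by simp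
    rw [e, norm_star]
    exact hxV g h hgh

theorem RUCB.mem_iff (x : G →ᵇ ℂ) : x ∈ RUCB G ↔ IsRightUniformlyContinuous (x : G → ℂ) := Iff.rfl

theorem RUCB.isClosed : IsClosed (RUCB G : Set (G →ᵇ ℂ)) := by
  refine isClosed_of_closure_subset fun x hx ε hε => ?_
  obtain ⟨y, hy, hxy⟩ := Metric.mem_closure_iff.1 hx (ε / 3) (by positivity)
  obtain ⟨V, hV, hyV⟩ := hy (ε / 3) (by positivity)
  refine ⟨V, hV, fun g h hgh => ?_⟩
  have h1 := (x.dist_coe_le_dist (g := y) g).trans_lt hxy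
  have h2 := (x.dist_coe_le_dist (g := y) h).trans_lt hxy
  have h3 := hyV g h hgh
  rw [dist_eq_norm] at h1 h2
  rw [norm_sub_rev] at h2
  have e : x g - x h = (x g - y g) + (y g - y h) + (y h - x h) := by ring
  rw [e]
  exact (norm_add₃_le ..).trans_lt (by linarith)

instance RUCB.instCompleteSpace : CompleteSpace (RUCB G) :=
  (RUCB.isClosed G).completeSpace_coe

/-- Every bounded right uniformly continuous function on a topological group is an element of
`RUCB(G)`. -/
noncomputable def RUCB.ofBounded {G : Type u} [Group G] [TopologicalSpace G] [IsTopologicalGroup G] (x : G → ℂ)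
    (hx : IsRightUniformlyContinuous x) (hb : ∃ C : ℝ, ∀ g, ‖x g‖ ≤ C) : RUCB G :=
  ⟨BoundedContinuousFunction.ofNormedAddCommGroup x
    (by
      refine continuous_iff_continuousAt.2 fun h => Metric.continuousAt_iff'.2 fun ε hε => ?_
      obtain ⟨V, hV, hxV⟩ := hx ε hε
      have hc : Filter.Tendsto (fun g : G => g * h⁻¹) (𝓝 h) (𝓝 1) := by
        have : Continuous fun g : G => g * h⁻¹ := by fun_prop
        simpa using this.tendsto h
      filter_upwards [hc hV] with g hg
      rw [dist_eq_norm]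
      exact hxV g h hg)
    hb.choose hb.choose_spec, hx⟩

end RUCB

/-! ### The equivariant Samuel compactification -/

section Samuel

variable {G : Type u} [Group G] [TopologicalSpace G] [IsTopologicalGroup G]

/-- Left translation on `RUCB(G)`: `(translate g x)(h) = x(g⁻¹ h)`. -/
noncomputable def RUCB.translate (g : G) : RUCB G →⋆ₐ[ℂ] RUCB G where
  toFun x := ⟨x.1.compContinuous ⟨fun h => g⁻¹ * h, by fun_prop⟩, by
    intro ε hε
    obtain ⟨V, hV, hxV⟩ := x.2 ε hε
    have hc : Filter.Tendsto (fun a : G => g⁻¹ * a * g) (𝓝 1) (𝓝 1) := by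
      have : Continuous fun a : G => g⁻¹ * a * g := by fun_prop
      simpa using this.tendsto 1
    refine ⟨_, hc hV, fun a b hab => ?_⟩
    refine hxV (g⁻¹ * a) (g⁻¹ * b) ?_
    have e : g⁻¹ * a * (g⁻¹ * b)⁻¹ = g⁻¹ * (a * b⁻¹) * g := by group
    rw [e]
    exact hab⟩
  map_one' := rfl
  map_mul' _ _ := rfl
  map_zero' := rfl
  map_add' _ _ := rfl
  commutes' _ := rfl
  map_star' _ := rfl

theorem RUCB.translate_apply (g : G) (x : RUCB G) (h : G) :
    (RUCB.translate g x).1 h = x.1 (g⁻¹ * h) := rfl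

variable (G) in
/-- The equivariant Samuel compactification `S(G)` (the greatest ambit of `G`): the space of nonzero
continuous characters of the commutative C⋆-algebra `RUCB(G)`, with the weak-⋆ topology. -/
abbrev SamuelCompactification : Type u := WeakDual.characterSpace ℂ (RUCB G)

/-- The action of `G` on `S(G)`: `(g • φ)(x) = φ(g⁻¹ • x)`. -/
noncomputable instance SamuelCompactification.instMulAction :
    MulAction G (SamuelCompactification G) where
  smul g φ := WeakDual.CharacterSpace.compContinuousMap (RUCB.translate g⁻¹) φ
  one_smul φ := by
    refine WeakDual.CharacterSpace.ext fun x => ?_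
    change φ (RUCB.translate (1 : G)⁻¹ x) = φ x
    congr 1
    ext h
    simp [RUCB.translate_apply]
  mul_smul g g' φ := by
    refine WeakDual.CharacterSpace.ext fun x => ?_
    change φ (RUCB.translate (g * g')⁻¹ x) = φ (RUCB.translate g'⁻¹ (RUCB.translate g⁻¹ x))
    congr 1
    ext h
    simp [RUCB.translate_apply, mul_assoc]

theorem SamuelCompactification.smul_apply (g : G) (φ : SamuelCompactification G) (x : RUCB G) :
    (g • φ) x = φ (RUCB.translate g⁻¹ x) := rfl

end Samuel

/-! ### Projective systems of compact `G`-spaces -/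

/-- A projective system of compact (Hausdorff) `G`-spaces, indexed by a nonempty directed ordered
set. The transition maps are morphisms of `G`-spaces, i.e. continuous equivariant maps. -/
structure ProjectiveSystem (G : Type u) [Group G] [TopologicalSpace G] where
  ι : Type u
  [partialOrder : PartialOrder ι]
  [nonempty : Nonempty ι]
  [directed : IsDirectedOrder ι]
  X : ι → Type u
  [topologicalSpace : ∀ i, TopologicalSpace (X i)]
  [compactSpace : ∀ i, CompactSpace (X i)]
  [t2Space : ∀ i, T2Space (X i)]
  [mulAction : ∀ i, MulAction G (X i)]
  [continuousSMul : ∀ i, ContinuousSMul G (X i)]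
  π : ∀ i j : ι, i ≤ j → X j → X i
  π_continuous : ∀ i j (h : i ≤ j), Continuous (π i j h)
  π_smul : ∀ i j (h : i ≤ j) (g : G) (x : X j), π i j h (g • x) = g • π i j h x
  π_refl : ∀ i (x : X i), π i i le_rfl x = x
  π_comp : ∀ i j k (hij : i ≤ j) (hjk : j ≤ k) (x : X k),
    π i j hij (π j k hjk x) = π i k (hij.trans hjk) x

namespace ProjectiveSystem

variable {G : Type u} [Group G] [TopologicalSpace G] (P : ProjectiveSystem G)

attribute [instance] partialOrder nonempty directed topologicalSpace compactSpace t2Space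
  mulAction continuousSMul

/-- The projective limit, with the topology induced by the product. -/
def Limit : Type u := {x : ∀ i, P.X i // ∀ i j (h : i ≤ j), x i = P.π i j h (x j)}

instance : TopologicalSpace P.Limit :=
  inferInstanceAs (TopologicalSpace {x : ∀ i, P.X i // ∀ i j (h : i ≤ j), x i = P.π i j h (x j)})

/-- `G` acts on the projective limit coordinatewise. -/
instance : MulAction G P.Limit where
  smul g x := ⟨fun i => g • x.1 i, fun i j h => by rw [P.π_smul, ← x.2 i j h]⟩
  one_smul x := Subtype.ext (funext fun i => one_smul G (x.1 i))
  mul_smul g g' x := Subtype.ext (funext fun i => mul_smul g g' (x.1 i))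

/-- All transition maps are surjective. -/
def IsSurjective : Prop := ∀ i j (h : i ≤ j), Function.Surjective (P.π i j h)

/-- The `G`-space `Y` is (isomorphic, as a topological `G`-space, to) the limit of `P`. -/
def HasLimit (Y : Type u) [TopologicalSpace Y] [MulAction G Y] : Prop :=
  ∃ e : Y ≃ₜ P.Limit, ∀ (g : G) (y : Y), e (g • y) = g • e y

end ProjectiveSystem

/-! ### Lebesgue covering dimension -/

/-- Every family of members of `𝒱` with a common point has at most `n + 1` elements. -/
def CoverOrderLE {X : Type u} (𝒱 : Set (Set X)) (n : ℕ) : Prop :=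
  ∀ s : Finset (Set X), (s : Set (Set X)) ⊆ 𝒱 → (⋂₀ (s : Set (Set X))).Nonempty → s.card ≤ n + 1

/-- Every open cover of `X` has an open refinement of order at most `n`. -/
def LebesgueDimLE (X : Type u) [TopologicalSpace X] (n : ℕ) : Prop :=
  ∀ 𝒰 : Set (Set X), (∀ U ∈ 𝒰, IsOpen U) → ⋃₀ 𝒰 = Set.univ →
    ∃ 𝒱 : Set (Set X), (∀ V ∈ 𝒱, IsOpen V) ∧ ⋃₀ 𝒱 = Set.univ ∧
      (∀ V ∈ 𝒱, ∃ U ∈ 𝒰, V ⊆ U) ∧ CoverOrderLE 𝒱 n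

/-- The Lebesgue covering dimension: the least `n : ℕ` such that every open cover has an open
refinement of order at most `n`, and `⊤` if there is none. -/
noncomputable def lebesgueDim (X : Type u) [TopologicalSpace X] : ℕ∞ :=
  ⨅ (n : ℕ) (_ : LebesgueDimLE X n), (n : ℕ∞)

/-!
The theorem splits into a fact about `S(G)` and a fact about compact `G`-spaces.

`S(G)` is a zero-dimensional compact `G`-space into which `G` maps continuously, injectively and
densely. Density of the evaluations is Gelfand duality together with Urysohn's lemma
(`RUCB.denseRange_eval`), and joint continuity of the action holds because `G` acts on `RUCB(G)`
with norm-continuous orbit maps. Zero-dimensionality is where `G` has to be non-archimedean: if two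
characters differ at `x`, saturating a sublevel set of `x` under a small open subgroup `H` gives a
set `A` with `H A = A`, whose indicator function lies in `RUCB(G)` and defines a clopen subset of
`S(G)` separating the two characters.

Let `K` be any zero-dimensional compact `G`-space, with `G` second-countable. By compactness the
stabilizer in `G` of a continuous function `K → Bool` is open, so the orbit of the function is
countable, and every countable family of such functions lies in a countable invariant family `𝒜`.
The image of `K` in `𝒜 → Bool` is a zero-dimensional compact metrizable factor of the `G`-space
`K`. These factors, indexed by the families ordered by inclusion, form a projective system with
surjective transition maps and limit `K` (`factorSystem_hasLimit`).

Suppose that `G` is not discrete, so that it has no isolated points. As `G` is second-countable and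
injects into `S(G)`, countably many functions separate its points in `S(G)`. Restricting the system
to the families containing these, `G` injects continuously and densely into every factor, which
therefore has no isolated points and is a Cantor space by Brouwer's theorem
(`nonempty_homeomorph_cantor`). If `G` is discrete, every factor is multiplied by a Cantor space
with trivial action, on which all transition maps but the identities are constant
(`ProjectiveSystem.thicken`); the spaces become Cantor spaces, and the limit does not change.
-/

/-! ### Zero-dimensional compact spaces -/

/-- In a totally separated space, the continuous `Bool`-valued functions separate points. -/
theorem exists_continuousMap_bool_ne {K : Type*} [TopologicalSpace K] [TotallySeparatedSpace K]
    {x y : K} (hxy : x ≠ y) : ∃ f : C(K, Bool), f x ≠ f y := by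
  classical
  obtain ⟨U, hU, hx, hy⟩ := exists_isClopen_of_totally_separated hxy
  refine ⟨⟨fun z => decide (z ∈ U), ?_⟩, ?_⟩
  · exact (IsLocallyConstant.iff_continuous _).1 <| (IsLocallyConstant.iff_eventually_eq _).2
      fun z => by
        by_cases hz : z ∈ U
        · filter_upwards [hU.isOpen.mem_nhds hz] with w hw
          simp [hz, hw]
        · filter_upwards [hU.compl.isOpen.mem_nhds hz] with w hw
          simp [hz, show w ∉ U from hw]
  · simp [hx, show y ∉ U from hy]

/-- If a second-countable space `Y` injects continuously into a totally separated space `K`, then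
countably many continuous functions `K → Bool` already separate the points of `Y`: the pairs
separated by a given function form an open set, and the off-diagonal of `Y × Y` is Lindelöf. -/
theorem exists_countable_bool_separating {Y K : Type*} [TopologicalSpace Y] [SecondCountableTopology Y]
    [TopologicalSpace K] [TotallySeparatedSpace K] {j : Y → K} (hj : Continuous j)
    (hinj : Function.Injective j) :
    ∃ 𝒜 : Set C(K, Bool), 𝒜.Countable ∧ ∀ x y, x ≠ y → ∃ f ∈ 𝒜, f (j x) ≠ f (j y) := by
  have hU (f : C(K, Bool)) : IsOpen {p : Y × Y | f (j p.1) ≠ f (j p.2)} :=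
    (isClosed_eq (by fun_prop) (by fun_prop)).isOpen_compl
  obtain ⟨T, hT, hTU⟩ := TopologicalSpace.isOpen_iUnion_countable _ hU
  refine ⟨T, hT, fun x y hxy => ?_⟩
  obtain ⟨f, hf⟩ := exists_continuousMap_bool_ne (hinj.ne hxy)
  have : (x, y) ∈ ⋃ f : C(K, Bool), {p : Y × Y | f (j p.1) ≠ f (j p.2)} :=
    Set.mem_iUnion.2 ⟨f, hf⟩
  rw [← hTU] at this
  simpa using this

theorem lebesgueDim_eq_zero (X : Type u) [TopologicalSpace X] [CompactSpace X] [T2Space X]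
    [TotallyDisconnectedSpace X] : lebesgueDim X = 0 := by
  suffices h : LebesgueDimLE X 0 by
    refine le_antisymm ?_ bot_le
    exact (iInf₂_le 0 h).trans (by simp)
  intro 𝒰 hO hcov
  have hloc (x : X) : ∃ V : Set X, IsClopen V ∧ x ∈ V ∧ ∃ U ∈ 𝒰, V ⊆ U := by
    obtain ⟨U, hU, hxU⟩ : x ∈ ⋃₀ 𝒰 := hcov ▸ Set.mem_univ x
    obtain ⟨V, hV, hxV, hVU⟩ := compact_exists_isClopen_in_isOpen (hO U hU) hxU
    exact ⟨V, hV, hxV, U, hU, hVU⟩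
  choose D hD hxD hDU using hloc
  obtain ⟨t, ht⟩ := isCompact_univ.elim_finite_subcover D (fun x => (hD x).isOpen)
    fun x _ => Set.mem_iUnion.2 ⟨x, hxD x⟩
  obtain ⟨C, hC, -, hCD, hcovC, hdisj⟩ := exists_clopen_partition_of_clopen_cover
    (I := t) (Z := fun _ => ∅) (D := fun i => D i) (fun _ => isClosed_empty) (fun i => hD i)
    (fun _ => Set.empty_subset _) (fun _ _ _ _ _ => by simp [Function.onFun])
  refine ⟨Set.range C, ?_, ?_, ?_, ?_⟩
  · rintro _ ⟨i, rfl⟩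
    exact (hC i).isOpen
  · refine Set.eq_univ_of_forall fun x => ?_
    have hx : x ∈ ⋃ i : t, D i := by simpa using ht (Set.mem_univ x)
    simpa using hcovC hx
  · rintro _ ⟨i, rfl⟩
    obtain ⟨U, hU, h⟩ := hDU i
    exact ⟨U, hU, (hCD i).trans h⟩
  · rintro s hs ⟨p, hp⟩
    refine Finset.card_le_one.2 fun A hA B hB => ?_
    obtain ⟨i, rfl⟩ := hs hA
    obtain ⟨k, rfl⟩ := hs hB
    by_contra hne
    exact Set.disjoint_left.1 (hdisj (Set.mem_univ i) (Set.mem_univ k) fun h => hne (h ▸ rfl))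
      (hp _ hA) (hp _ hB)

/-! ### Brouwer's characterization of the Cantor space -/

section Brouwer

variable {X : Type*} (D : ℕ → Set X → Set X)

open Classical in
/-- The cell of level `n` containing `x`, for the scheme that cuts a cell `U` of level `n` into
`U ∩ D n U` and `U \ D n U`. -/
noncomputable def cell (x : X) : ℕ → Set X
  | 0 => Set.univ
  | n + 1 => if x ∈ D n (cell x n) then cell x n ∩ D n (cell x n) else cell x n \ D n (cell x n)

/-- The cell of level `n` along the branch `b` of the scheme of `cell`. -/
def branchCell (b : ℕ → Bool) : ℕ → Set X
  | 0 => Set.univ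
  | n + 1 => if b n then branchCell b n ∩ D n (branchCell b n)
      else branchCell b n \ D n (branchCell b n)

open Classical in
/-- The branch of the scheme of `cell` followed by the point `x`. -/
noncomputable def address (x : X) (n : ℕ) : Bool := decide (x ∈ D n (cell D x n))

theorem mem_cell (x : X) (n : ℕ) : x ∈ cell D x n := by
  induction n with
  | zero => exact Set.mem_univ x
  | succ n ih =>
    rw [cell]
    split_ifs with h
    exacts [⟨ih, h⟩, ⟨ih, h⟩]

theorem cell_eq_branchCell (x : X) (n : ℕ) : cell D x n = branchCell D (address D x) n := by
  induction n with
  | zero => rfl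
  | succ n ih =>
    rw [cell, branchCell, ← ih]
    by_cases h : x ∈ D n (cell D x n) <;> simp [address, h]

theorem cell_succ_subset (x : X) (n : ℕ) : cell D x (n + 1) ⊆ cell D x n := by
  rw [cell]
  split_ifs
  exacts [Set.inter_subset_left, Set.sdiff_subset]

theorem cell_eq_of_mem {x y : X} {n : ℕ} (h : y ∈ cell D x n) : cell D y n = cell D x n := by
  induction n with
  | zero => rfl
  | succ n ih =>
    have hn := ih (cell_succ_subset D x n h)
    rw [cell, cell, hn]
    rw [cell] at h
    split_ifs at h with hx
    · simp [hx, h.2]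
    · simp [hx, h.2]

theorem address_eq_of_mem {x y : X} {n : ℕ} (h : y ∈ cell D x (n + 1)) :
    address D y n = address D x n := by
  have hn := cell_eq_of_mem D (cell_succ_subset D x n h)
  rw [address, address, hn]
  rw [cell] at h
  split_ifs at h with hx
  · simp [hx, h.2]
  · simp [hx, h.2]

theorem address_eq_of_forall_mem_branchCell {x : X} {b : ℕ → Bool}
    (h : ∀ n, x ∈ branchCell D b n) : address D x = b := by
  have hb (n : ℕ) (hn : cell D x n = branchCell D b n) : address D x n = b n := by
    have h' := h (n + 1)
    rw [branchCell] at h'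
    rw [address, hn]
    cases hbn : b n <;> simp [hbn] at h' <;> simp [h'.2]
  have hc (n : ℕ) : cell D x n = branchCell D b n := by
    induction n with
    | zero => rfl
    | succ n ih =>
      have := hb n ih
      rw [cell_eq_branchCell, branchCell, branchCell, this, ← cell_eq_branchCell, ih]
  exact funext fun n => hb n (hc n)

/-- **Brouwer's theorem**: a nonempty compact Hausdorff second-countable totally disconnected space
without isolated points is homeomorphic to the Cantor space. -/
theorem nonempty_homeomorph_cantor (X : Type*) [TopologicalSpace X] [CompactSpace X] [T2Space X]
    [SecondCountableTopology X] [TotallyDisconnectedSpace X] [PerfectSpace X] [Nonempty X] :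
    Nonempty (X ≃ₜ (ℕ → Bool)) := by
  obtain ⟨𝒜, h𝒜, hsep⟩ := exists_countable_bool_separating continuous_id (K := X)
    Function.injective_id
  -- The constant function is added so that the family is nonempty and can be enumerated.
  obtain ⟨f, hf⟩ := (h𝒜.insert (ContinuousMap.const X true)).exists_eq_range
    (Set.insert_nonempty _ _)
  -- Every nonempty clopen set can be cut into two nonempty clopen pieces on which `f n` is constant:
  -- along `f n` if it is not constant, along any clopen set separating two points otherwise.
  have hsplit (n : ℕ) (U : Set X) (hU : IsClopen U) (hne : U.Nonempty) :
      ∃ D : Set X, IsClopen D ∧ (U ∩ D).Nonempty ∧ (U \ D).Nonempty ∧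
        (∀ x ∈ U ∩ D, ∀ y ∈ U ∩ D, f n x = f n y) ∧
        (∀ x ∈ U \ D, ∀ y ∈ U \ D, f n x = f n y) := by
    by_cases hc : ∀ x ∈ U, ∀ y ∈ U, f n x = f n y
    · obtain ⟨x, hx⟩ := hne
      obtain ⟨y, hy, hyx⟩ := (infinite_of_mem_nhds x (hU.isOpen.mem_nhds hx)).nontrivial.exists_ne x
      obtain ⟨D, hD, hxD, hyD⟩ := exists_isClopen_of_totally_separated hyx.symm
      exact ⟨D, hD, ⟨x, hx, hxD⟩, ⟨y, hy, hyD⟩, fun a ha b hb => hc a ha.1 b hb.1,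
        fun a ha b hb => hc a ha.1 b hb.1⟩
    · push Not at hc
      obtain ⟨x, hx, y, hy, hxy⟩ := hc
      refine ⟨f n ⁻¹' {f n x}, (isClopen_discrete _).preimage (f n).continuous, ⟨x, hx, rfl⟩,
        ⟨y, hy, fun h => hxy h.symm⟩, fun a ha b hb => ?_, fun a ha b hb => ?_⟩
      · exact (show f n a = f n x from ha.2).trans (show f n b = f n x from hb.2).symm
      · have h1 : f n a ≠ f n x := ha.2
        have h2 : f n b ≠ f n x := hb.2
        revert h1 h2
        cases f n a <;> cases f n b <;> cases f n x <;> simp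
  choose! D hD hD1 hD2 hD3 hD4 using hsplit
  have hV (b : ℕ → Bool) (n : ℕ) : IsClopen (branchCell D b n) ∧ (branchCell D b n).Nonempty := by
    induction n with
    | zero => exact ⟨isClopen_univ, Set.univ_nonempty⟩
    | succ n ih =>
      rw [branchCell]
      split_ifs
      · exact ⟨ih.1.inter (hD n _ ih.1 ih.2), hD1 n _ ih.1 ih.2⟩
      · exact ⟨ih.1.diff (hD n _ ih.1 ih.2), hD2 n _ ih.1 ih.2⟩
  have hW (x : X) (n : ℕ) : IsClopen (cell D x n) := cell_eq_branchCell D x n ▸ (hV _ n).1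
  have hcont : Continuous (address D) := continuous_pi fun n =>
    (IsLocallyConstant.iff_continuous _).1 <| (IsLocallyConstant.iff_eventually_eq _).2 fun x => by
      filter_upwards [(hW x (n + 1)).isOpen.mem_nhds (mem_cell D x (n + 1))] with y hy
      exact address_eq_of_mem D hy
  have hinj : Function.Injective (address D) := by
    intro x y hxy
    by_contra hne
    obtain ⟨g, hg, hgxy⟩ := hsep x y hne
    obtain ⟨n, rfl⟩ : g ∈ Set.range f := hf ▸ Set.mem_insert_of_mem _ hg
    have hy : y ∈ cell D x (n + 1) := by
      rw [cell_eq_branchCell, hxy, ← cell_eq_branchCell]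
      exact mem_cell D y (n + 1)
    have hx := mem_cell D x (n + 1)
    have hne' : (cell D x n).Nonempty := ⟨x, mem_cell D x n⟩
    rw [cell] at hx hy
    split_ifs at hx hy
    · exact hgxy (hD3 n _ (hW x n) hne' x hx y hy)
    · exact hgxy (hD4 n _ (hW x n) hne' x hx y hy)
  have hsurj : Function.Surjective (address D) := by
    intro b
    obtain ⟨x, hx⟩ := IsCompact.nonempty_iInter_of_sequence_nonempty_isCompact_isClosed
      (branchCell D b)
      (fun n => by
        rw [branchCell]
        split_ifs
        exacts [Set.inter_subset_left, Set.sdiff_subset])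
      (fun n => (hV b n).2) (hV b 0).1.isClosed.isCompact (fun n => (hV b n).1.isClosed)
    exact ⟨x, address_eq_of_forall_mem_branchCell D fun n => Set.mem_iInter.1 hx n⟩
  exact ⟨hcont.homeoOfEquivCompactToT2 (f := Equiv.ofBijective _ ⟨hinj, hsurj⟩)⟩

end Brouwer

/-- A space into which a perfect space maps continuously, injectively and densely is perfect. -/
theorem PerfectSpace.of_injective_denseRange {Y X : Type*} [TopologicalSpace Y] [PerfectSpace Y]
    [TopologicalSpace X] {j : Y → X} (hj : Continuous j)
    (hinj : Function.Injective j) (hd : DenseRange j) : PerfectSpace X := by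
  rw [perfectSpace_iff_forall_not_isolated]
  intro x
  rw [← mem_closure_iff_nhdsWithin_neBot, mem_closure_iff_nhds]
  intro U hU
  obtain ⟨V, hVU, hV, hxV⟩ := mem_nhds_iff.1 hU
  obtain ⟨y, hy⟩ := hd.exists_mem_open hV ⟨x, hxV⟩
  have := perfectSpace_iff_forall_not_isolated.1 ‹PerfectSpace Y› y
  rw [← mem_closure_iff_nhdsWithin_neBot, mem_closure_iff_nhds] at this
  obtain ⟨z, hz, hzy⟩ := this _ ((hV.preimage hj).mem_nhds hy)
  by_cases h : j y = x
  · exact ⟨j z, hVU hz, fun h' => hzy (hinj (Eq.trans h' h.symm))⟩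
  · exact ⟨j y, hVU hy, h⟩

/-! ### Metrizable factors of a zero-dimensional compact `G`-space -/

section Factors

variable {G : Type u} [Group G] [TopologicalSpace G]
variable {K : Type u} [TopologicalSpace K] [MulAction G K] [ContinuousSMul G K]

/-- The function `x ↦ f (g • x)`. -/
def pullback (g : G) (f : C(K, Bool)) : C(K, Bool) := ⟨fun x => f (g • x), by fun_prop⟩

@[simp]
theorem pullback_apply (g : G) (f : C(K, Bool)) (x : K) : pullback g f x = f (g • x) := rfl

theorem pullback_pullback (g h : G) (f : C(K, Bool)) :
    pullback g (pullback h f) = pullback (h * g) f := by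
  ext x
  simp [mul_smul]

theorem pullback_one (f : C(K, Bool)) : pullback (1 : G) f = f := by
  ext x
  simp

/-- On a compact `G`-space, a translate of a continuous `Bool`-valued function depends on the
translating element in a locally constant way. -/
theorem eventually_pullback_eq [CompactSpace K] (f : C(K, Bool)) (g₀ : G) :
    ∀ᶠ g in 𝓝 g₀, pullback g f = pullback g₀ f := by
  have h : ∀ᶠ g in 𝓝 g₀, ∀ x ∈ (Set.univ : Set K), f (g • x) = f (g₀ • x) := by
    refine isCompact_univ.eventually_forall_of_forall_eventually fun x _ => ?_
    have hopen : IsOpen {p : G × K | f (p.1 • p.2) = f (g₀ • p.2)} :=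
      (isClopen_discrete {p : Bool × Bool | p.1 = p.2}).isOpen.preimage
        (f := fun p : G × K => (f (p.1 • p.2), f (g₀ • p.2))) (by fun_prop)
    exact hopen.mem_nhds (x := (g₀, x)) rfl
  filter_upwards [h] with g hg
  exact ContinuousMap.ext fun x => hg x trivial

/-- The stabilizers of `f` under translation are open, so its orbit is countable. -/
theorem countable_range_pullback [SecondCountableTopology G] [CompactSpace K] (f : C(K, Bool)) :
    (Set.range fun g : G => pullback g f).Countable := by
  obtain ⟨s, hs, hcov⟩ := TopologicalSpace.countable_cover_nhds
    (f := fun g₀ : G => {g | pullback g f = pullback g₀ f}) (eventually_pullback_eq f)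
  refine (hs.image fun g => pullback g f).mono ?_
  rintro _ ⟨g, rfl⟩
  obtain ⟨g₀, hg₀, hg⟩ := Set.mem_iUnion₂.1 (hcov ▸ Set.mem_univ g)
  exact ⟨g₀, hg₀, Eq.symm hg⟩

variable (G) in
/-- The countable `G`-invariant families of continuous functions `K → Bool` containing `𝒜₀`,
ordered by inclusion. -/
def InvariantFamily (𝒜₀ : Set C(K, Bool)) : Type u :=
  {𝒜 : Set C(K, Bool) // 𝒜.Countable ∧ 𝒜₀ ⊆ 𝒜 ∧ ∀ (g : G), ∀ f ∈ 𝒜, pullback g f ∈ 𝒜}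

namespace InvariantFamily

variable {𝒜₀ : Set C(K, Bool)}

instance : PartialOrder (InvariantFamily G 𝒜₀) :=
  inferInstanceAs (PartialOrder {𝒜 : Set C(K, Bool) // 𝒜.Countable ∧ 𝒜₀ ⊆ 𝒜 ∧
    ∀ (g : G), ∀ f ∈ 𝒜, pullback g f ∈ 𝒜})

instance : IsDirectedOrder (InvariantFamily G 𝒜₀) where
  directed 𝒜 ℬ := ⟨⟨𝒜.1 ∪ ℬ.1, 𝒜.2.1.union ℬ.2.1, 𝒜.2.2.1.trans Set.subset_union_left,
    fun g f hf => hf.imp (𝒜.2.2.2 g f) (ℬ.2.2.2 g f)⟩, Set.subset_union_left,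
    Set.subset_union_right⟩

theorem le_iff {𝒜 ℬ : InvariantFamily G 𝒜₀} : 𝒜 ≤ ℬ ↔ 𝒜.1 ⊆ ℬ.1 := Iff.rfl

theorem exists_subset [SecondCountableTopology G] [CompactSpace K] (h𝒜₀ : 𝒜₀.Countable)
    {ℬ : Set C(K, Bool)} (hℬ : ℬ.Countable) : ∃ 𝒜 : InvariantFamily G 𝒜₀, ℬ ⊆ 𝒜.1 := by
  have hsub : 𝒜₀ ∪ ℬ ⊆ ⋃ f ∈ 𝒜₀ ∪ ℬ, Set.range fun g : G => pullback g f := fun f hf =>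
    Set.mem_iUnion₂.2 ⟨f, hf, 1, pullback_one f⟩
  refine ⟨⟨⋃ f ∈ 𝒜₀ ∪ ℬ, Set.range fun g : G => pullback g f,
    (h𝒜₀.union hℬ).biUnion fun f _ => countable_range_pullback f,
    Set.subset_union_left.trans hsub, fun g f hf => ?_⟩, Set.subset_union_right.trans hsub⟩
  obtain ⟨f', hf', h, rfl⟩ := Set.mem_iUnion₂.1 hf
  exact Set.mem_iUnion₂.2 ⟨f', hf', h * g, (pullback_pullback g h f').symm⟩

/-- The `G`-space `K` modulo the relation of not being separated by `𝒜`, realized as the image of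
`K` in `𝒜 → Bool`. -/
def Factor (𝒜 : InvariantFamily G 𝒜₀) : Type u :=
  Set.range fun (x : K) (f : 𝒜.1) => f.1 x

variable (𝒜 : InvariantFamily G 𝒜₀)

instance : TopologicalSpace 𝒜.Factor :=
  inferInstanceAs (TopologicalSpace (Set.range fun (x : K) (f : 𝒜.1) => f.1 x))

instance : T2Space 𝒜.Factor :=
  inferInstanceAs (T2Space (Set.range fun (x : K) (f : 𝒜.1) => f.1 x))

instance : TotallyDisconnectedSpace 𝒜.Factor :=
  inferInstanceAs (TotallyDisconnectedSpace (Set.range fun (x : K) (f : 𝒜.1) => f.1 x))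

instance : SecondCountableTopology 𝒜.Factor :=
  have : Countable 𝒜.1 := 𝒜.2.1
  inferInstanceAs (SecondCountableTopology (Set.range fun (x : K) (f : 𝒜.1) => f.1 x))

/-- The quotient map from `K` to its factor. -/
def toFactor (x : K) : 𝒜.Factor := ⟨fun f => f.1 x, x, rfl⟩

theorem toFactor_surjective : Function.Surjective 𝒜.toFactor := by
  rintro ⟨_, x, rfl⟩
  exact ⟨x, rfl⟩

theorem continuous_toFactor : Continuous 𝒜.toFactor :=
  Continuous.subtype_mk (continuous_pi fun f => f.1.continuous) _

theorem toFactor_eq_iff {x y : K} : 𝒜.toFactor x = 𝒜.toFactor y ↔ ∀ f ∈ 𝒜.1, f x = f y := by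
  refine Subtype.ext_iff.trans (funext_iff.trans ?_)
  simp [toFactor]

instance [CompactSpace K] : CompactSpace 𝒜.Factor :=
  𝒜.toFactor_surjective.compactSpace 𝒜.continuous_toFactor

instance : SMul G 𝒜.Factor where
  smul g y := ⟨fun f => y.1 ⟨pullback g f.1, 𝒜.2.2.2 g _ f.2⟩, by
    obtain ⟨_, x, rfl⟩ := y
    exact ⟨g • x, rfl⟩⟩

theorem toFactor_smul (g : G) (x : K) : 𝒜.toFactor (g • x) = g • 𝒜.toFactor x := rfl

instance : MulAction G 𝒜.Factor := 𝒜.toFactor_surjective.mulAction 𝒜.toFactor 𝒜.toFactor_smul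

instance [CompactSpace K] : ContinuousSMul G 𝒜.Factor where
  continuous_smul := by
    -- As `K` is compact, `id × toFactor` is a closed map, hence a quotient map.
    have hq : IsQuotientMap (Prod.map id 𝒜.toFactor : G × K → G × 𝒜.Factor) :=
      (isProperMap_id.prodMap 𝒜.continuous_toFactor.isProperMap).isClosedMap.isQuotientMap
        (by have := 𝒜.continuous_toFactor; fun_prop)
        (Function.surjective_id.prodMap 𝒜.toFactor_surjective)
    rw [hq.continuous_iff]
    exact 𝒜.continuous_toFactor.comp (continuous_smul (M := G) (X := K))

/-- The map from the factor of a larger family to the factor of a smaller one. -/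
def restrict {𝒜 ℬ : InvariantFamily G 𝒜₀} (h : 𝒜 ≤ ℬ) (y : ℬ.Factor) : 𝒜.Factor :=
  ⟨fun f => y.1 ⟨f.1, le_iff.1 h f.2⟩, by
    obtain ⟨_, x, rfl⟩ := y
    exact ⟨x, rfl⟩⟩

theorem continuous_restrict {𝒜 ℬ : InvariantFamily G 𝒜₀} (h : 𝒜 ≤ ℬ) :
    Continuous (restrict h) :=
  Continuous.subtype_mk (continuous_pi fun f =>
    (continuous_apply (⟨f.1, le_iff.1 h f.2⟩ : ℬ.1)).comp continuous_subtype_val) _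

end InvariantFamily

open InvariantFamily

/-- The projective system of all factors of `K` given by countable invariant families containing
`𝒜₀`, with the restriction maps as transition maps. -/
def factorSystem [SecondCountableTopology G] [CompactSpace K] {𝒜₀ : Set C(K, Bool)}
    (h𝒜₀ : 𝒜₀.Countable) : ProjectiveSystem G where
  ι := InvariantFamily G 𝒜₀
  nonempty := ⟨(exists_subset h𝒜₀ Set.countable_empty).choose⟩
  X 𝒜 := 𝒜.Factor
  π _ _ h := restrict h
  π_continuous _ _ h := continuous_restrict h
  π_smul _ _ _ _ _ := rfl
  π_refl _ _ := rfl
  π_comp _ _ _ _ _ _ := rfl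

theorem factorSystem_isSurjective [SecondCountableTopology G] [CompactSpace K]
    {𝒜₀ : Set C(K, Bool)} (h𝒜₀ : 𝒜₀.Countable) : (factorSystem (G := G) h𝒜₀).IsSurjective := by
  intro 𝒜 ℬ h y
  obtain ⟨x, rfl⟩ := InvariantFamily.toFactor_surjective 𝒜 y
  exact ⟨InvariantFamily.toFactor ℬ x, rfl⟩

instance ProjectiveSystem.instT2SpaceLimit (P : ProjectiveSystem G) : T2Space P.Limit :=
  inferInstanceAs (T2Space {x : ∀ i, P.X i // ∀ i j (h : i ≤ j), x i = P.π i j h (x j)})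

theorem ProjectiveSystem.continuous_coord (P : ProjectiveSystem G) (i : P.ι) :
    Continuous fun x : P.Limit => x.1 i :=
  (continuous_apply i).comp continuous_subtype_val

/-- Each function in `C(K, Bool)` lies in a countable invariant family, so the factors separate the
points of `K`; every thread comes from a point of `K` by compactness. -/
theorem factorSystem_hasLimit [SecondCountableTopology G] [CompactSpace K] [T2Space K]
    [TotallyDisconnectedSpace K] {𝒜₀ : Set C(K, Bool)} (h𝒜₀ : 𝒜₀.Countable) :
    (factorSystem (G := G) h𝒜₀).HasLimit K := by
  set P := factorSystem (G := G) h𝒜₀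
  let F : K → P.Limit := fun x => ⟨fun 𝒜 : InvariantFamily G 𝒜₀ => 𝒜.toFactor x, fun _ _ _ => rfl⟩
  have hF : Continuous F :=
    Continuous.subtype_mk
      (continuous_pi fun 𝒜 : InvariantFamily G 𝒜₀ => 𝒜.continuous_toFactor) _
  have hinj : Function.Injective F := by
    intro x y hxy
    by_contra hne
    obtain ⟨f, hf⟩ := exists_continuousMap_bool_ne hne
    obtain ⟨𝒜, h𝒜⟩ := exists_subset (G := G) h𝒜₀ (Set.countable_singleton f)
    exact hf (𝒜.toFactor_eq_iff.1 (congrFun (congrArg Subtype.val hxy) 𝒜) f (h𝒜 rfl))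
  have hsurj : Function.Surjective F := by
    intro y
    have hcl (𝒜 : InvariantFamily G 𝒜₀) : IsClosed (𝒜.toFactor ⁻¹' {y.1 𝒜}) :=
      (isClosed_singleton (X := 𝒜.Factor)).preimage 𝒜.continuous_toFactor
    have : Nonempty (InvariantFamily G 𝒜₀) := P.nonempty
    obtain ⟨x, hx⟩ := IsCompact.nonempty_iInter_of_directed_nonempty_isCompact_isClosed
      (fun 𝒜 : InvariantFamily G 𝒜₀ => 𝒜.toFactor ⁻¹' {y.1 𝒜})
      (fun 𝒜 ℬ =>
        let ⟨𝒞, h𝒜, hℬ⟩ := exists_ge_ge 𝒜 ℬ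
        ⟨𝒞, fun _ hx => Eq.trans (congrArg (restrict h𝒜) hx) (y.2 𝒜 𝒞 h𝒜).symm,
          fun _ hx => Eq.trans (congrArg (restrict hℬ) hx) (y.2 ℬ 𝒞 hℬ).symm⟩)
      (fun 𝒜 => 𝒜.toFactor_surjective (y.1 𝒜)) (fun 𝒜 => (hcl 𝒜).isCompact) hcl
    exact ⟨x, Subtype.ext (funext fun 𝒜 => Set.mem_iInter.1 hx 𝒜)⟩
  exact ⟨hF.homeoOfEquivCompactToT2 (f := Equiv.ofBijective F ⟨hinj, hsurj⟩), fun _ _ => rfl⟩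

/-- If a perfect second-countable space maps continuously, injectively and densely into `K`, then
all sufficiently fine factors of `K` are Cantor spaces: the composite with the map to a factor is
still injective, because the functions in `𝒜₀` factor through it. -/
theorem exists_countable_forall_factor_homeomorph_cantor [CompactSpace K] [T2Space K]
    [TotallyDisconnectedSpace K] {Y : Type*} [TopologicalSpace Y] [SecondCountableTopology Y]
    [PerfectSpace Y] [Nonempty Y] {j : Y → K} (hj : Continuous j) (hinj : Function.Injective j)
    (hd : DenseRange j) :
    ∃ 𝒜₀ : Set C(K, Bool), 𝒜₀.Countable ∧
      ∀ 𝒜 : InvariantFamily G 𝒜₀, Nonempty (𝒜.Factor ≃ₜ (ℕ → Bool)) := by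
  obtain ⟨𝒜₀, h𝒜₀, hsep⟩ := exists_countable_bool_separating hj hinj
  refine ⟨𝒜₀, h𝒜₀, fun 𝒜 => ?_⟩
  have : PerfectSpace 𝒜.Factor := by
    refine PerfectSpace.of_injective_denseRange (𝒜.continuous_toFactor.comp hj) ?_
      (𝒜.toFactor_surjective.denseRange.comp hd 𝒜.continuous_toFactor)
    intro x y hxy
    by_contra hne
    obtain ⟨f, hf, hfxy⟩ := hsep x y hne
    exact hfxy (𝒜.toFactor_eq_iff.1 hxy f (𝒜.2.2.1 hf))
  have : Nonempty 𝒜.Factor := ‹Nonempty Y›.map fun y => 𝒜.toFactor (j y)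
  exact nonempty_homeomorph_cantor 𝒜.Factor

end Factors

/-! ### Thickening a projective system by a Cantor factor -/

namespace ProjectiveSystem

variable {G : Type u} [Group G] [TopologicalSpace G]

/-- A point can be moved within any neighbourhood by changing its second coordinate
at a single large index. -/
instance instPerfectSpaceProdCantor (X : Type*) [TopologicalSpace X] :
    PerfectSpace (X × (ℕ → Bool)) := by
  rw [perfectSpace_iff_forall_not_isolated]
  rintro ⟨x, c⟩
  rw [← mem_closure_iff_nhdsWithin_neBot]
  have hc : Filter.Tendsto (fun n => Function.update c n (!c n)) Filter.atTop (𝓝 c) := by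
    refine tendsto_pi_nhds.2 fun k => tendsto_const_nhds.congr' ?_
    filter_upwards [Filter.eventually_gt_atTop k] with n hn
    rw [Function.update_of_ne hn.ne]
  refine mem_closure_of_tendsto (tendsto_const_nhds (x := x) |>.prodMk_nhds hc) ?_
  refine Filter.Eventually.of_forall fun n h => ?_
  have := congrFun (congrArg Prod.snd h) n
  simp at this

/-- The product of `X` and the Cantor space. A group acting on `X` acts on it through the first
coordinate. -/
def Thickening (X : Type u) : Type u := X × (ℕ → Bool)

namespace Thickening

variable (X : Type u) [TopologicalSpace X]

instance : TopologicalSpace (Thickening X) := inferInstanceAs (TopologicalSpace (X × (ℕ → Bool)))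

instance [CompactSpace X] : CompactSpace (Thickening X) :=
  inferInstanceAs (CompactSpace (X × (ℕ → Bool)))

instance [T2Space X] : T2Space (Thickening X) := inferInstanceAs (T2Space (X × (ℕ → Bool)))

instance [MulAction G X] : MulAction G (Thickening X) where
  smul g y := (g • y.1, y.2)
  one_smul y := Prod.ext (one_smul G y.1) rfl
  mul_smul g h y := Prod.ext (mul_smul g h y.1) rfl

instance [MulAction G X] [ContinuousSMul G X] : ContinuousSMul G (Thickening X) :=
  ⟨show Continuous fun z : G × X × (ℕ → Bool) => (z.1 • z.2.1, z.2.2) by fun_prop⟩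

instance : PerfectSpace (Thickening X) := inferInstanceAs (PerfectSpace (X × (ℕ → Bool)))

theorem nonempty_homeomorph_cantor [CompactSpace X] [T2Space X] [SecondCountableTopology X]
    [TotallyDisconnectedSpace X] [Nonempty X] : Nonempty (Thickening X ≃ₜ (ℕ → Bool)) := by
  have : SecondCountableTopology (Thickening X) :=
    inferInstanceAs (SecondCountableTopology (X × (ℕ → Bool)))
  have : TotallyDisconnectedSpace (Thickening X) :=
    inferInstanceAs (TotallyDisconnectedSpace (X × (ℕ → Bool)))
  have : Nonempty (Thickening X) := inferInstanceAs (Nonempty (X × (ℕ → Bool)))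
  exact _root_.nonempty_homeomorph_cantor (Thickening X)

end Thickening

open Classical in
/-- The projective system of the spaces `P.X i × 2^ℕ`, indexed by `P.ι × ℕ`, in which `G` acts
trivially on the second coordinate. All transition maps except the identities send the second
coordinate to a base point, so that the limit is that of `P`; the index set is multiplied by `ℕ` to
have no maximal element. -/
noncomputable def thicken (P : ProjectiveSystem G) : ProjectiveSystem G where
  ι := P.ι × ℕ
  directed := ⟨fun p q =>
    let ⟨i, hp, hq⟩ := exists_ge_ge p.1 q.1
    ⟨(i, max p.2 q.2), Prod.le_def.2 ⟨hp, le_max_left _ _⟩, Prod.le_def.2 ⟨hq, le_max_right _ _⟩⟩⟩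
  X p := Thickening (P.X p.1)
  π p q h y := (P.π p.1 q.1 (Prod.le_def.1 h).1 y.1, if p = q then y.2 else fun _ => false)
  π_continuous p q h := by
    change Continuous fun y : P.X q.1 × (ℕ → Bool) =>
      (P.π p.1 q.1 (Prod.le_def.1 h).1 y.1, if p = q then y.2 else fun _ => false)
    have := P.π_continuous p.1 q.1 (Prod.le_def.1 h).1
    split_ifs <;> fun_prop
  π_smul p q h g y := Prod.ext (P.π_smul p.1 q.1 (Prod.le_def.1 h).1 g y.1) rfl
  π_refl p y := Prod.ext (P.π_refl p.1 y.1) (if_pos rfl)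
  π_comp p q r hpq hqr y := by
    refine Prod.ext (P.π_comp p.1 q.1 r.1 (Prod.le_def.1 hpq).1 (Prod.le_def.1 hqr).1 y.1) ?_
    by_cases h : p = r
    · subst h
      obtain rfl := le_antisymm hpq hqr
      simp
    · by_cases h' : p = q
      · subst h'
        simp
      · simp [h, h']

theorem HasLimit.thicken {P : ProjectiveSystem G} {Y : Type u} [TopologicalSpace Y] [MulAction G Y]
    (h : P.HasLimit Y) : P.thicken.HasLimit Y := by
  obtain ⟨e, he⟩ := h
  -- Comparing `p` with `(p.1, p.2 + 1)` shows that a thread has the base point as its second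
  -- coordinate at `p`; comparing it with `(p.1, 0)` determines the first coordinate.
  have hcoord (y : P.thicken.Limit) (p : P.ι × ℕ) :
      y.1 p = ((y.1 (p.1, 0)).1, fun _ => false) := by
    have h1 := y.2 (p.1, 0) p ⟨le_rfl, Nat.zero_le _⟩
    have h2 := y.2 p (p.1, p.2 + 1) ⟨le_rfl, Nat.le_succ _⟩
    have hne : p ≠ (p.1, p.2 + 1) := fun h => by simpa using congrArg Prod.snd h
    refine Prod.ext ?_ ?_
    · exact ((congrArg Prod.fst h1).trans (P.π_refl p.1 (y.1 p).1)).symm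
    · exact (congrArg Prod.snd h2).trans (if_neg hne)
  let E : P.Limit ≃ₜ P.thicken.Limit :=
    { toFun := fun x => ⟨fun p => (x.1 p.1, fun _ => false), fun p q h =>
        Prod.ext (x.2 p.1 q.1 h.1) (ite_self _).symm⟩
      invFun := fun y => ⟨fun i => (y.1 (i, 0)).1, fun i k h =>
        congrArg Prod.fst (y.2 (i, 0) (k, 0) ⟨h, le_rfl⟩)⟩
      left_inv := fun _ => rfl
      right_inv := fun y => Subtype.ext (funext fun p => (hcoord y p).symm)
      continuous_toFun := Continuous.subtype_mk (continuous_pi fun p =>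
        (P.continuous_coord p.1).prodMk continuous_const) _
      continuous_invFun := Continuous.subtype_mk (continuous_pi fun i =>
        continuous_fst.comp (P.thicken.continuous_coord (i, 0))) _ }
  refine ⟨e.trans E, fun g y => ?_⟩
  change E (e (g • y)) = _
  rw [he]
  rfl

end ProjectiveSystem

/-! ### The equivariant Samuel compactification of a non-archimedean group -/

section Samuel

variable {G : Type u} [Group G] [TopologicalSpace G]

namespace RUCB

instance instIsClosed : IsClosed (RUCB G : Set (G →ᵇ ℂ)) := RUCB.isClosed G

/-- Evaluation at `g`, as a character of `RUCB(G)`. -/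
noncomputable def eval (g : G) : SamuelCompactification G :=
  WeakDual.CharacterSpace.equivAlgHom.symm
    { toFun := fun x => x.1 g
      map_one' := rfl
      map_mul' := fun _ _ => rfl
      map_zero' := rfl
      map_add' := fun _ _ => rfl
      commutes' := fun _ => rfl }

theorem eval_apply (g : G) (x : RUCB G) : eval g x = x.1 g := rfl

theorem continuous_apply_character (x : RUCB G) :
    Continuous fun φ : SamuelCompactification G => φ x :=
  (WeakDual.eval_continuous x).comp continuous_subtype_val

theorem continuous_iff_apply {Y : Type*} [TopologicalSpace Y] {F : Y → SamuelCompactification G} :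
    Continuous F ↔ ∀ x : RUCB G, Continuous fun y => F y x :=
  ⟨fun h x => (continuous_apply_character x).comp h, fun h =>
    Continuous.subtype_mk (WeakDual.continuous_of_continuous_eval h) fun y => (F y).2⟩

theorem continuous_eval : Continuous (eval : G → SamuelCompactification G) :=
  continuous_iff_apply.2 fun x => x.1.continuous

/-- A continuous function on `S(G)` is the Gelfand transform of some `x ∈ RUCB(G)`; if it vanishes
on the evaluations, then `x = 0`. Urysohn's lemma then excludes points outside their closure. -/
theorem denseRange_eval : DenseRange (eval : G → SamuelCompactification G) := by
  intro φ
  by_contra hφ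
  obtain ⟨f, hf0, hf1, -⟩ := exists_continuous_zero_one_of_isClosed
    (isClosed_closure (s := Set.range (eval : G → SamuelCompactification G)))
    (isClosed_singleton (x := φ)) (Set.disjoint_singleton_right.2 hφ)
  obtain ⟨x, hx⟩ := (gelfandTransform_bijective (RUCB G)).2
    (ContinuousMap.comp ⟨Complex.ofReal, Complex.continuous_ofReal⟩ f)
  have hval (ψ : SamuelCompactification G) : ψ x = (f ψ : ℂ) := DFunLike.congr_fun hx ψ
  have hx0 : x = 0 := by
    ext g
    have := hval (eval g)
    rw [hf0 (subset_closure ⟨g, rfl⟩)] at this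
    simpa [eval_apply] using this
  have := hval φ
  rw [hf1 rfl, hx0, map_zero] at this
  simp at this

/-- Density of the evaluations, in the form used to compute characters on indicator functions. -/
theorem exists_eval_mem_norm_sub_lt {φ : SamuelCompactification G} (x : RUCB G) {r : ℝ} (hr : 0 < r)
    {U : Set (SamuelCompactification G)} (hU : IsOpen U) (hφ : φ ∈ U) :
    ∃ g : G, eval g ∈ U ∧ ‖x.1 g - φ x‖ < r := by
  have hW : IsOpen {ψ : SamuelCompactification G | ‖ψ x - φ x‖ < r} :=
    isOpen_lt (((continuous_apply_character x).sub continuous_const).norm) continuous_const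
  obtain ⟨g, hg⟩ := denseRange_eval.exists_mem_open (hU.inter hW) ⟨φ, hφ, by simpa using hr⟩
  exact ⟨g, hg.1, hg.2⟩

variable [IsTopologicalGroup G]

/-- Right uniform continuity says that `G` acts on `RUCB(G)` with norm-continuous orbit maps. -/
theorem continuous_translate_inv (x : RUCB G) : Continuous fun g : G => translate g⁻¹ x := by
  refine continuous_iff_continuousAt.2 fun g₀ => Metric.continuousAt_iff'.2 fun ε hε => ?_
  obtain ⟨V, hV, hxV⟩ := x.2 (ε / 2) (by positivity)
  have hc : Filter.Tendsto (fun g : G => g * g₀⁻¹) (𝓝 g₀) (𝓝 1) := by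
    have : Continuous fun g : G => g * g₀⁻¹ := by fun_prop
    simpa using this.tendsto g₀
  filter_upwards [hc hV] with g hg
  refine lt_of_le_of_lt ?_ (half_lt_self hε)
  refine (BoundedContinuousFunction.dist_le (by positivity)).2 fun h => ?_
  rw [dist_eq_norm, translate_apply, translate_apply]
  refine (hxV _ _ ?_).le
  have e : g⁻¹⁻¹ * h * (g₀⁻¹⁻¹ * h)⁻¹ = g * g₀⁻¹ := by group
  rw [e]
  exact hg

instance : ContinuousSMul G (SamuelCompactification G) where
  continuous_smul := continuous_iff_apply.2 fun x => by
    have h1 : Continuous fun p : G × SamuelCompactification G =>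
        WeakDual.gelfandTransform ℂ (RUCB G) (translate p.1⁻¹ x) :=
      (gelfandTransform_isometry (RUCB G)).continuous.comp
        ((continuous_translate_inv x).comp continuous_fst)
    exact h1.eval continuous_snd

/-- The indicator function of a set `A` with `H A = A`, for an open subgroup `H`. -/
noncomputable def indicator (H : OpenSubgroup G) (A : Set G)
    (hA : ∀ h ∈ H, ∀ a, h * a ∈ A ↔ a ∈ A) : RUCB G :=
  RUCB.ofBounded (A.indicator 1)
    (fun ε hε => ⟨H, H.mem_nhds_one, fun g h hgh => by
      have : g ∈ A ↔ h ∈ A := by simpa using hA _ hgh h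
      by_cases hh : h ∈ A
      · simpa [hh, this.2 hh] using hε
      · simpa [hh, mt this.1 hh] using hε⟩)
    ⟨1, fun g => by by_cases hg : g ∈ A <;> simp [hg]⟩

theorem indicator_apply (H : OpenSubgroup G) (A : Set G)
    (hA : ∀ h ∈ H, ∀ a, h * a ∈ A ↔ a ∈ A) (g : G) :
    (indicator H A hA).1 g = A.indicator 1 g := rfl

/-- Indicator functions are idempotent, so a character takes only the values `0` and `1` on them. -/
theorem isClopen_indicator (H : OpenSubgroup G) (A : Set G)
    (hA : ∀ h ∈ H, ∀ a, h * a ∈ A ↔ a ∈ A) :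
    IsClopen {φ : SamuelCompactification G | φ (indicator H A hA) = 1} := by
  have hc := continuous_apply_character (indicator H A hA)
  refine ⟨isClosed_eq hc continuous_const, ?_⟩
  have hmul : indicator H A hA * indicator H A hA = indicator H A hA := by
    ext g
    change A.indicator (1 : G → ℂ) g * A.indicator (1 : G → ℂ) g = A.indicator (1 : G → ℂ) g
    by_cases hg : g ∈ A <;> simp [hg]
  have e : {φ : SamuelCompactification G | φ (indicator H A hA) = 1} =
      {φ | φ (indicator H A hA) = 0}ᶜ := by
    ext φ
    have h : φ (indicator H A hA) * φ (indicator H A hA) = φ (indicator H A hA) := by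
      rw [← map_mul, hmul]
    refine ⟨fun h1 h0 => one_ne_zero (h1.symm.trans h0), fun h0 => ?_⟩
    exact mul_left_cancel₀ h0 (h.trans (mul_one _).symm)
  rw [e]
  exact (isClosed_eq hc continuous_const).isOpen_compl

end RUCB

end Samuel

section Nonarchimedean

variable {G : Type u} [Group G] [TopologicalSpace G] [NonarchimedeanGroup G]

open RUCB

/-- If `φ x ≠ ψ x`, let `H` be an open subgroup moving `x` by less than `|φ x - ψ x| / 2`. The
`H`-saturation of the set where `x` is close to `φ x` does not meet the set where `x` is close to
`ψ x`, so the clopen set defined by its indicator function separates `φ` from `ψ`. -/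
instance SamuelCompactification.instTotallySeparatedSpace :
    TotallySeparatedSpace (SamuelCompactification G) := by
  refine totallySeparatedSpace_iff_exists_isClopen.2 fun φ ψ hne => ?_
  obtain ⟨x, hx⟩ : ∃ x : RUCB G, φ x ≠ ψ x := by
    by_contra! h
    exact hne (WeakDual.CharacterSpace.ext h)
  set r := ‖φ x - ψ x‖ with hr
  have hr0 : 0 < r := norm_pos_iff.2 (sub_ne_zero.2 hx)
  obtain ⟨V, hV, hxV⟩ := x.2 (r / 2) (by positivity)
  obtain ⟨H, hH⟩ := NonarchimedeanGroup.is_nonarchimedean V hV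
  let A : Set G := {g | ∃ h ∈ H, ‖x.1 (h * g) - φ x‖ < r / 4}
  have hA : ∀ h ∈ H, ∀ a, h * a ∈ A ↔ a ∈ A := by
    refine fun h hh a => ⟨fun ⟨k, hk, hka⟩ => ⟨k * h, mul_mem hk hh, ?_⟩,
      fun ⟨k, hk, hka⟩ => ⟨k * h⁻¹, mul_mem hk (inv_mem hh), ?_⟩⟩
    · rwa [mul_assoc]
    · simpa [mul_assoc] using hka
  have hcl := isClopen_indicator H A hA
  refine ⟨_, hcl, ?_, ?_⟩
  · by_contra hφ
    obtain ⟨g, hg, hgx⟩ := exists_eval_mem_norm_sub_lt x (show 0 < r / 4 by positivity)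
      hcl.compl.isOpen hφ
    have hgA : g ∈ A := ⟨1, one_mem H, by simpa using hgx⟩
    exact hg (by simp [eval_apply, indicator_apply, hgA])
  · intro hψ
    obtain ⟨g, hg, hgx⟩ := exists_eval_mem_norm_sub_lt x (show 0 < r / 4 by positivity) hcl.isOpen hψ
    have hgA : g ∈ A := by
      by_contra hgA
      have : eval g (indicator H A hA) = 1 := hg
      simp [eval_apply, indicator_apply, hgA] at this
    obtain ⟨h, hh, hhx⟩ := hgA
    have h1 := hxV (h * g) g (by simpa using hH hh)
    have e : φ x - ψ x = (x.1 g - ψ x) + (x.1 (h * g) - x.1 g) - (x.1 (h * g) - φ x) := by ring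
    have h2 : r ≤ ‖x.1 g - ψ x‖ + ‖x.1 (h * g) - x.1 g‖ + ‖x.1 (h * g) - φ x‖ := by
      rw [hr, e]
      exact (norm_sub_le _ _).trans (by gcongr; exact norm_add_le _ _)
    linarith

/-- Distinct points lie in distinct right cosets of a small open subgroup. -/
theorem RUCB.eval_injective [T1Space G] :
    Function.Injective (eval : G → SamuelCompactification G) := by
  intro g k hgk
  by_contra hne
  obtain ⟨H, hH⟩ := NonarchimedeanGroup.is_nonarchimedean ({g * k⁻¹}ᶜ : Set G)
    (isOpen_compl_singleton.mem_nhds fun h => hne (mul_inv_eq_one.1 (Eq.symm h)))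
  let A : Set G := {a | a * k⁻¹ ∈ H}
  have hA : ∀ h ∈ H, ∀ a, h * a ∈ A ↔ a ∈ A := fun h hh a => by
    change h * a * k⁻¹ ∈ H.toSubgroup ↔ a * k⁻¹ ∈ H.toSubgroup
    rw [mul_assoc, Subgroup.mul_mem_cancel_left _ hh]
  have h := congrArg (fun φ : SamuelCompactification G => φ (indicator H A hA)) hgk
  have hg : g ∉ A := fun hg => hH hg rfl
  have hk : k ∈ A := by simp [A, one_mem H]
  simp [eval_apply, indicator_apply, hg, hk] at h

end Nonarchimedean

theorem perfectSpace_of_not_discreteTopology {G : Type*} [Group G] [TopologicalSpace G]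
    [IsTopologicalGroup G] (hG : ¬ DiscreteTopology G) : PerfectSpace G := by
  refine perfectSpace_iff_forall_not_isolated.2 fun x => ⟨fun hx => hG ?_⟩
  refine discreteTopology_of_isOpen_singleton_one ?_
  have := ((isOpen_singleton_iff_punctured_nhds x).2 hx).preimage (continuous_const_mul x)
  simpa [Set.preimage] using this

theorem mainTheorem4 (G : Type u) [Group G] [TopologicalSpace G] [PolishSpace G]
    [NonarchimedeanGroup G] :
    (∃ P : ProjectiveSystem G,
      (∀ i, TopologicalSpace.MetrizableSpace (P.X i) ∧ lebesgueDim (P.X i) = 0) ∧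
      P.IsSurjective ∧
      P.HasLimit (SamuelCompactification G)) ∧
    (Infinite G →
      ∃ P : ProjectiveSystem G,
        (∀ i, Nonempty (P.X i ≃ₜ (ℕ → Bool))) ∧
        (¬ DiscreteTopology G → P.IsSurjective) ∧
        P.HasLimit (SamuelCompactification G)) := by
  refine ⟨⟨factorSystem Set.countable_empty, fun 𝒜 => ?_, factorSystem_isSurjective _,
    factorSystem_hasLimit _⟩, fun _ => ?_⟩
  · let ℬ : InvariantFamily G (∅ : Set C(SamuelCompactification G, Bool)) := 𝒜
    exact ⟨TopologicalSpace.metrizableSpace_of_t3_secondCountable ℬ.Factor,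
      lebesgueDim_eq_zero ℬ.Factor⟩
  by_cases hG : DiscreteTopology G
  · refine ⟨(factorSystem (G := G) (K := SamuelCompactification G) Set.countable_empty).thicken,
      fun p => ?_, fun h => (h hG).elim, (factorSystem_hasLimit _).thicken⟩
    let 𝒜 : InvariantFamily G (∅ : Set C(SamuelCompactification G, Bool)) := p.1
    have : Nonempty 𝒜.Factor := ⟨𝒜.toFactor (RUCB.eval 1)⟩
    exact ProjectiveSystem.Thickening.nonempty_homeomorph_cantor 𝒜.Factor
  · have : PerfectSpace G := perfectSpace_of_not_discreteTopology hG
    obtain ⟨𝒜₀, h𝒜₀, hcantor⟩ := exists_countable_forall_factor_homeomorph_cantor (G := G)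
      (RUCB.continuous_eval (G := G)) RUCB.eval_injective RUCB.denseRange_eval
    exact ⟨factorSystem h𝒜₀, hcantor, fun _ => factorSystem_isSurjective h𝒜₀,
      factorSystem_hasLimit h𝒜₀⟩
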